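/- Let $R$ be a Dedekind domain whose field of fractions $K$ has characteristic $0$. By a group scheme over a scheme $S$ we mean a commutative group object in the category of $S$-schemes, and we call it finite flat if its structure morphism to $S$ is finite and flat. A sequence $0\to H\xrightarrow{\,i\,} E\xrightarrow{\,p\,} G\to 0$ of finite flat group schemes over $S$ is exact if $i$ is the kernel of $p$ and $p$ is faithfully flat; it is then called an extension of $G$ by $H$. Let $\mathrm{Ext}^1_S(G,H)$ be the set of extensions of $G$ by $H$ in finite flat group schemes over $S$, modulo isomorphisms of the middle terms that induce the identity on $H$ and on $G$. Let $G$ and $H$ be finite flat group schemes over $R$. Suppose that $G$ is, up to isomorphism, the only prolongation of its generic fibre $G_K$ to $R$; that is, every finite flat group scheme $G'$ over $R$ with $G'_K\cong G_K$ as group schemes over $K$ is isomorphic to $G$ as a group scheme over $R$. Then the base change map $$\mathrm{Ext}^1_R(G,H)\longrightarrow \mathrm{Ext}^1_K(G_K,H_K),\qquad [E]\longmapsto [E_K],$$ is injective. -/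

import Mathlib

open CategoryTheory CategoryTheory.Limits MonoidalCategory CartesianMonoidalCategory MonObj
  AlgebraicGeometry

universe u

namespace FFGroupScheme

/-- Group schemes over `S` are commutative group objects in the category of `S`-schemes. -/
abbrev GroupScheme (S : Scheme.{u}) : Type (u + 1) := CommGrp (Over S)

/-- The morphism of `S`-schemes underlying a homomorphism of group schemes. -/
abbrev homOver {S : Scheme.{u}} {G H : GroupScheme S} (φ : G ⟶ H) : G.X ⟶ H.X := φ.hom.hom.hom

/-- The group scheme `G` is finite and flat over its base. -/
structure IsFiniteFlat {S : Scheme.{u}} (G : GroupScheme S) : Prop where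
  finite : IsFinite G.X.hom
  flat : Flat G.X.hom

/-- Base change of group schemes along `f : S' ⟶ S`, i.e. `G ↦ G ×_S S'`. -/
noncomputable def baseChange {S S' : Scheme.{u}} (f : S' ⟶ S) : GroupScheme S ⥤ GroupScheme S' :=
  (Over.pullback f).mapCommGrp

/-- The sequence `0 ⟶ H ⟶ E ⟶ G ⟶ 0` of group schemes over `S` is exact: `i` is the kernel of
`p` (the fibre of `p` over the unit section of `G`) and `p` is faithfully flat. -/
structure IsShortExact {S : Scheme.{u}} {H E G : GroupScheme S} (i : H ⟶ E) (p : E ⟶ G) :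
    Prop where
  kernel : IsPullback (homOver i) (toUnit H.X) (homOver p) η[G.X]
  flat : Flat (homOver p).left
  surjective : Surjective (homOver p).left

lemma IsFiniteFlat.baseChange {S S' : Scheme.{u}} (f : S' ⟶ S) {G : GroupScheme S}
    (hG : IsFiniteFlat G) : IsFiniteFlat ((baseChange f).obj G) where
  finite := by
    have := hG.finite
    exact inferInstanceAs (IsFinite (pullback.snd G.X.hom f))
  flat := by
    have := hG.flat
    exact inferInstanceAs (Flat (pullback.snd G.X.hom f))

/-- The base change of a morphism of `S`-schemes `g : X ⟶ Y` is the pullback of `g` along the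
projection `Y ×_S S' ⟶ Y`. -/
lemma isPullback_pullback_map_left {S S' : Scheme.{u}} (f : S' ⟶ S) {X Y : Over S} (g : X ⟶ Y) :
    IsPullback (pullback.fst X.hom f) ((Over.pullback f).map g).left g.left
      (pullback.fst Y.hom f) := by
  have h1 : IsPullback (pullback.fst Y.hom f) (pullback.snd Y.hom f) Y.hom f :=
    IsPullback.of_hasPullback _ _
  have h2 : IsPullback (pullback.fst X.hom f)
      (((Over.pullback f).map g).left ≫ pullback.snd Y.hom f) (g.left ≫ Y.hom) f := by
    have e : ((Over.pullback f).map g).left ≫ pullback.snd Y.hom f = pullback.snd X.hom f :=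
      Over.w ((Over.pullback f).map g)
    rw [e, Over.w g]
    exact IsPullback.of_hasPullback _ _
  refine (IsPullback.of_right h2.flip ?_ h1.flip).flip
  exact pullback.lift_fst _ _ _

lemma IsShortExact.baseChange {S S' : Scheme.{u}} (f : S' ⟶ S) {H E G : GroupScheme S}
    {i : H ⟶ E} {p : E ⟶ G} (h : IsShortExact i p) :
    IsShortExact ((baseChange f).map i) ((baseChange f).map p) where
  kernel := by
    have : PreservesLimitsOfSize.{0, 0} (Over.pullback f) :=
      (Over.mapPullbackAdj f).rightAdjoint_preservesLimits
    have h1 := h.kernel.map (Over.pullback f)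
    refine h1.of_iso (Iso.refl _) (Iso.refl _) (Functor.Monoidal.εIso (Over.pullback f)).symm
      (Iso.refl _) ?_ ?_ ?_ ?_
    · exact (Category.comp_id _).trans (Category.id_comp _).symm
    · exact toUnit_unique _ _
    · exact (Category.comp_id _).trans (Category.id_comp _).symm
    · have e : η[((FFGroupScheme.baseChange f).obj G).X] =
          Functor.LaxMonoidal.ε (Over.pullback f) ≫ (Over.pullback f).map η[G.X] := rfl
      rw [e]
      refine (Category.comp_id _).trans ?_
      exact ((Functor.Monoidal.εIso (Over.pullback f)).inv_hom_id_assoc _).symm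
  flat := by
    exact MorphismProperty.of_isPullback (P := @Flat)
      (isPullback_pullback_map_left f (homOver p)) h.flat
  surjective :=
    MorphismProperty.of_isPullback (P := @Surjective)
      (isPullback_pullback_map_left f (homOver p)) h.surjective

/-- An extension `0 ⟶ H ⟶ E ⟶ G ⟶ 0` of `G` by `H` in finite flat group schemes over `S`. -/
structure Extension {S : Scheme.{u}} (G H : GroupScheme S) : Type (u + 1) where
  E : GroupScheme S
  isFiniteFlat : IsFiniteFlat E
  i : H ⟶ E
  p : E ⟶ G
  exact : IsShortExact i p

namespace Extension

variable {S S' : Scheme.{u}} {G H : GroupScheme S}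

/-- Two extensions of `G` by `H` are equivalent if there is an isomorphism of group schemes
between their middle terms inducing the identity on `H` and on `G`. -/
def Equivalent (X Y : Extension G H) : Prop :=
  ∃ e : X.E ≅ Y.E, X.i ≫ e.hom = Y.i ∧ e.hom ≫ Y.p = X.p

instance setoid (G H : GroupScheme S) : Setoid (Extension G H) where
  r := Equivalent
  iseqv :=
    { refl := fun X => ⟨Iso.refl _, by simp, by simp⟩
      symm := by
        rintro X Y ⟨e, h1, h2⟩
        exact ⟨e.symm, by simp [← h1], by simp [← h2]⟩
      trans := by
        rintro X Y Z ⟨e, h1, h2⟩ ⟨e', h1', h2'⟩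
        exact ⟨e ≪≫ e', by simp [reassoc_of% h1, h1'], by simp [h2, h2']⟩ }

/-- Base change of an extension along `f : S' ⟶ S`. -/
noncomputable def baseChange (f : S' ⟶ S) (X : Extension G H) :
    Extension ((FFGroupScheme.baseChange f).obj G) ((FFGroupScheme.baseChange f).obj H) where
  E := (FFGroupScheme.baseChange f).obj X.E
  isFiniteFlat := X.isFiniteFlat.baseChange f
  i := (FFGroupScheme.baseChange f).map X.i
  p := (FFGroupScheme.baseChange f).map X.p
  exact := X.exact.baseChange f

lemma Equivalent.baseChange (f : S' ⟶ S) {X Y : Extension G H} (h : Equivalent X Y) :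
    Equivalent (X.baseChange f) (Y.baseChange f) := by
  obtain ⟨e, h1, h2⟩ := h
  refine ⟨(FFGroupScheme.baseChange f).mapIso e, ?_, ?_⟩
  · simp [Extension.baseChange, ← h1]
  · simp [Extension.baseChange, ← h2]

end Extension

/-- `Ext¹_S(G, H)`: equivalence classes of extensions of `G` by `H` in finite flat group schemes
over `S`. -/
def Ext1 {S : Scheme.{u}} (G H : GroupScheme S) : Type (u + 1) :=
  Quotient (Extension.setoid G H)

/-- The base change map `Ext¹_S(G, H) ⟶ Ext¹_{S'}(G_{S'}, H_{S'})`, sending the class of an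
extension to the class of its base change. -/
noncomputable def Ext1.baseChange {S S' : Scheme.{u}} (f : S' ⟶ S) (G H : GroupScheme S) :
    Ext1 G H → Ext1 ((FFGroupScheme.baseChange f).obj G) ((FFGroupScheme.baseChange f).obj H) :=
  Quotient.map (Extension.baseChange f) fun _ _ h => Extension.Equivalent.baseChange f h

/-- The morphism of affine schemes attached to an algebra `A` over `R`. -/
noncomputable abbrev specMap (R A : Type u) [CommRing R] [CommRing A] [Algebra R A] :
    Spec (CommRingCat.of A) ⟶ Spec (CommRingCat.of R) :=
  Spec.map (CommRingCat.ofHom (algebraMap R A))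

/-- `P` is a prolongation along `f : S' ⟶ S` of the group scheme `Γ` over `S'`: it is a finite
flat group scheme over `S` whose base change to `S'` is isomorphic to `Γ`. -/
def IsProlongation {S S' : Scheme.{u}} (f : S' ⟶ S) (Γ : GroupScheme S') (P : GroupScheme S) :
    Prop :=
  IsFiniteFlat P ∧ Nonempty ((baseChange f).obj P ≅ Γ)

/-- Up to isomorphism of group schemes over `S`, `P` is the only prolongation of `Γ` along `f`. -/
def IsUniqueProlongation {S S' : Scheme.{u}} (f : S' ⟶ S) (Γ : GroupScheme S')
    (P : GroupScheme S) : Prop :=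
  IsProlongation f Γ P ∧ ∀ Q : GroupScheme S, IsProlongation f Γ Q → Nonempty (Q ≅ P)

end FFGroupScheme

/-!
Let `φ : E_K ⟶ E'_K` be an isomorphism between the generic fibres of two extensions of `G` by `H`.
Homomorphisms out of a finite flat group scheme are determined by their restriction to the generic
fibre, so it is enough to extend `φ` to a morphism `E ⟶ E'`; by symmetry its inverse extends too.

Let `Γ` be the schematic closure of the graph of `φ` in `E × E'` (`exists_graphClosure`), with its
projections `p₁ : Γ ⟶ E`, an isomorphism on generic fibres, and `p₂ : Γ ⟶ E'`. A section of `p₁`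
followed by `p₂` extends `φ`, so it is enough to find such a section.

The first point is that the composite `Γ ⟶ E ⟶ G` is *saturated*: it is injective with torsion-free
cokernel on coordinate rings (`saturated_graphClosure`). The saturation of `O(G)` in `O(Γ)` is the
coordinate ring of a finite flat scheme `Q` between `Γ` and `G`, with the same generic fibre as `G`.
Saturated morphisms lift against generic isomorphisms (`Saturated.exists_lift`), so that the group
operations descend from `Γ` to `Q`, and `Q` is a prolongation of `G_K`. By hypothesis it is
isomorphic to `G`, and `Q ⟶ G` becomes an endomorphism of `G` that is invertible on the generic
fibre. In characteristic zero `G_K` is reduced by Cartier's theorem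
(`isReduced_of_finite_hopfAlgebra`), hence has only finitely many endomorphisms; therefore a power
of this endomorphism is the identity, and `Q ⟶ G` is an isomorphism
(`IsUniqueProlongation.isIso_of_genericIso`).

Now saturatedness survives the flat base change `E ⟶ G` (`Saturated.of_isPullback`), so the
projection `T = E ×_G Γ ⟶ E` is saturated. The points `x` and `p₁ γ` of `E` attached to a point
`(x, γ)` of `T` have the same image in `G`; hence `x = p₁ γ + i h` with `h` in `H`, and
`(x, γ) ↦ p₂ γ + i' h` extends `φ` on `T`, because `φ` is compatible with the inclusions `i` and
`i'` of `H`. In other words `T ⟶ E` lifts to `Γ`, and the lifting property of the saturated morphism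
`T ⟶ E` against `p₁` yields a section of `p₁` (`Extension.exists_map_eq`).
-/

namespace FFGroupScheme

/-! ### Finite Hopf algebras in characteristic zero -/

section Cartier

open Coalgebra TensorProduct

variable {K A : Type*} [Field K] [CommRing A] [HopfAlgebra K A]

/-- The translation-invariant operator `(id ⊗ l) ∘ Δ` on a Hopf algebra attached to a linear
functional `l`. -/
noncomputable def invariantOperator (l : A →ₗ[K] K) : A →ₗ[K] A :=
  (TensorProduct.rid K A).toLinearMap ∘ₗ l.lTensor A ∘ₗ comul

lemma invariantOperator_mul {l : A →ₗ[K] K}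
    (hl : ∀ a b, l (a * b) = counit (R := K) a * l b + counit (R := K) b * l a) (a b : A) :
    invariantOperator l (a * b) = a * invariantOperator l b + b * invariantOperator l a := by
  have key : ∀ x y : A ⊗[K] A,
      TensorProduct.rid K A (l.lTensor A (x * y)) =
        TensorProduct.rid K A ((counit (R := K) (A := A)).lTensor A x) *
            TensorProduct.rid K A (l.lTensor A y) +
          TensorProduct.rid K A ((counit (R := K) (A := A)).lTensor A y) *
            TensorProduct.rid K A (l.lTensor A x) := by
    intro x y
    induction x with
    | zero => simp
    | add x₁ x₂ h₁ h₂ => simp only [add_mul, mul_add, map_add, h₁, h₂]; ring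
    | tmul a b =>
      induction y with
      | zero => simp
      | add x₁ x₂ h₁ h₂ => simp only [add_mul, mul_add, map_add, h₁, h₂]; ring
      | tmul c d =>
        simp only [Algebra.TensorProduct.tmul_mul_tmul, LinearMap.lTensor_tmul,
          TensorProduct.rid_tmul, hl, Algebra.smul_def, map_add, map_mul]
        ring
  have := key (comul a) (comul b)
  simpa [invariantOperator, Coalgebra.lTensor_counit_comul] using this

lemma counit_invariantOperator (l : A →ₗ[K] K) (a : A) :
    counit (R := K) (invariantOperator l a) = l a := by
  have key : ∀ x : A ⊗[K] A, counit (R := K) (TensorProduct.rid K A (l.lTensor A x)) =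
      l (TensorProduct.lid K A ((counit (R := K) (A := A)).rTensor A x)) := by
    intro x
    induction x with
    | zero => simp
    | add x y hx hy => simp only [map_add, hx, hy]
    | tmul a b => simp [mul_comm]
  simpa [invariantOperator, Coalgebra.rTensor_counit_comul] using key (comul a)

lemma toConv_comp_antipode_mul_self {B : Type*} [CommRing B] [Algebra K B] (f : A →ₐ[K] B) :
    WithConv.toConv (f.comp (HopfAlgebra.antipodeAlgHom K A)) * WithConv.toConv f = 1 := by
  have h := AlgHom.comp_convMul_distrib f (WithConv.toConv (AlgHom.id K A))⁻¹
    (WithConv.toConv (AlgHom.id K A))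
  rw [inv_mul_cancel] at h
  apply WithConv.ofConv_injective
  refine Eq.trans h.symm ?_
  ext a
  simp [AlgHom.convOne_def]

lemma toConv_self_mul_comp_antipode {B : Type*} [CommRing B] [Algebra K B] (f : A →ₐ[K] B) :
    WithConv.toConv f * WithConv.toConv (f.comp (HopfAlgebra.antipodeAlgHom K A)) = 1 := by
  have h := AlgHom.comp_convMul_distrib f (WithConv.toConv (AlgHom.id K A))
    (WithConv.toConv (AlgHom.id K A))⁻¹
  rw [mul_inv_cancel] at h
  apply WithConv.ofConv_injective
  refine Eq.trans h.symm ?_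
  ext a
  simp [AlgHom.convOne_def]

variable [CharZero K] [Module.Finite K A]

/-- In characteristic zero a point derivation `l` at the origin of a finite group scheme vanishes:
if `l x = 1`, the invariant derivation `D` extending `l` satisfies `D ^ n (x ^ n) ≡ n !` modulo the
augmentation ideal `I`, although `x ^ n` lies in `I ^ n = I ^ (n + 1)` for large `n` and
`D ^ n (I ^ (n + 1)) ⊆ I`. -/
lemma pointDerivation_eq_zero {l : A →ₗ[K] K}
    (hl : ∀ a b, l (a * b) = counit (R := K) a * l b + counit (R := K) b * l a)
    {x : A} (hx : counit (R := K) x = 0) : l x = 0 := by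
  by_contra hlx
  set I : Ideal A := RingHom.ker (Bialgebra.counitAlgHom K A) with hI
  have memI (a : A) : a ∈ I ↔ counit (R := K) a = 0 := Iff.rfl
  set D := invariantOperator l with hD
  have hpow : ∀ k, ∀ a ∈ I ^ (k + 1), D a ∈ I ^ k := by
    intro k
    induction k with
    | zero => simp
    | succ k ih =>
      intro a ha
      rw [pow_succ'] at ha
      refine Submodule.mul_induction_on ha (fun a ha b hb => ?_) (fun a b ha hb => ?_)
      · rw [hD, invariantOperator_mul hl]
        refine Ideal.add_mem _ ?_ (Ideal.mul_mem_right _ _ hb)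
        rw [pow_succ']
        exact Ideal.mul_mem_mul ha (ih b hb)
      · rw [map_add]; exact Ideal.add_mem _ ha hb
  have hiter : ∀ k, ∀ a ∈ I ^ (k + 1), (D ^ k) a ∈ I := by
    intro k
    induction k with
    | zero => simp
    | succ k ih => intro a ha; rw [pow_succ]; exact ih _ (hpow _ _ ha)
  have hDx : ∀ k, D (x ^ (k + 1)) = (k + 1 : ℕ) • (x ^ k * D x) := by
    intro k
    induction k with
    | zero => simp
    | succ k ih =>
      rw [pow_succ, hD, invariantOperator_mul hl, ← hD, ih]
      simp only [nsmul_eq_mul]; push_cast; ring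
  have hfact : ∀ k, counit (R := K) ((D ^ k) (x ^ k)) = k.factorial * l x ^ k := by
    intro k
    induction k with
    | zero => simp
    | succ k ih =>
      -- modulo `I ^ (k + 1)`, the factor `D x` may be replaced by the scalar `l x`
      have h1 : x ^ k * D x - (l x) • x ^ k ∈ I ^ (k + 1) := by
        have : x ^ k * D x - (l x) • x ^ k = x ^ k * (D x - algebraMap K A (l x)) := by
          rw [Algebra.smul_def]; ring
        rw [this, pow_succ]
        refine Ideal.mul_mem_mul (Ideal.pow_mem_pow ((memI x).2 hx) k) ?_
        rw [memI, map_sub, hD, counit_invariantOperator, Bialgebra.counit_algebraMap, sub_self]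
      have h2 := (memI _).1 (hiter k _ h1)
      rw [map_sub, map_sub, sub_eq_zero, map_smul, map_smul, ih] at h2
      rw [pow_succ, Module.End.mul_apply, hDx, map_nsmul, map_nsmul, h2]
      simp only [nsmul_eq_mul, smul_eq_mul, Nat.factorial_succ]; push_cast; ring
  have : IsArtinianRing A := .of_finite K A
  obtain ⟨n, hn⟩ := IsArtinian.monotone_stabilizes
    (⟨fun n => OrderDual.toDual (I ^ n), fun a b h => Ideal.pow_le_pow_right h⟩ :
      ℕ →o (Submodule A A)ᵒᵈ)
  have hn' : I ^ n = I ^ (n + 1) := hn (n + 1) n.le_succ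
  have h3 := (memI _).1 (hiter n (x ^ n) (hn' ▸ Ideal.pow_mem_pow ((memI x).2 hx) n))
  rw [hfact] at h3
  exact mul_ne_zero (by exact_mod_cast n.factorial_ne_zero) (pow_ne_zero _ hlx) h3

variable (K A) in
/-- The cotangent space `I / I ^ 2` at the origin vanishes, since it has no nonzero functionals. -/
lemma augmentationIdeal_le_sq :
    RingHom.ker (Bialgebra.counitAlgHom K A) ≤ RingHom.ker (Bialgebra.counitAlgHom K A) ^ 2 := by
  intro x hx
  set I : Ideal A := RingHom.ker (Bialgebra.counitAlgHom K A) with hI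
  have memI (a : A) : a ∈ I ↔ counit (R := K) a = 0 := Iff.rfl
  by_contra hx2
  obtain ⟨g, hg, hker⟩ := Submodule.exists_le_ker_of_notMem
    (p := (I ^ 2).restrictScalars K) (v := x) (by simpa using hx2)
  have hker' : ∀ y ∈ I ^ 2, g y = 0 := fun y hy => hker hy
  have hsub (a : A) : a - algebraMap K A (counit a) ∈ I := by
    rw [memI, map_sub, Bialgebra.counit_algebraMap, sub_self]
  have hl := pointDerivation_eq_zero (K := K) (A := A) (x := x)
    (l := g ∘ₗ (LinearMap.id - (Algebra.linearMap K A) ∘ₗ counit)) (fun a b => by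
      have h0 := hker' _ (pow_two I ▸ Ideal.mul_mem_mul (hsub a) (hsub b))
      have h1 : a * b - algebraMap K A (counit (a * b)) =
          (a - algebraMap K A (counit a)) * (b - algebraMap K A (counit b)) +
          ((counit (R := K) a) • (b - algebraMap K A (counit b)) +
          (counit (R := K) b) • (a - algebraMap K A (counit a))) := by
        simp only [Algebra.smul_def, Bialgebra.counit_mul, map_mul]; ring
      simp only [LinearMap.comp_apply, LinearMap.sub_apply, LinearMap.id_apply,
        Algebra.linearMap_apply]
      rw [h1, map_add, h0, zero_add, map_add, map_smul, map_smul, smul_eq_mul, smul_eq_mul]) hx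
  have hx0 : counit (R := K) x = 0 := hx
  refine hg ?_
  simpa [hx0] using hl

variable (K A) in
/-- Two points with values in a square-zero thickening that agree modulo the square-zero ideal
differ by a point that is trivial modulo this ideal; it kills `I ^ 2 = I`, hence is trivial. -/
lemma formallyUnramified_of_finite_hopfAlgebra : Algebra.FormallyUnramified K A := by
  rw [Algebra.FormallyUnramified.iff_comp_injective]
  intro B _ _ N hN f g hfg
  set h : WithConv (A →ₐ[K] B) :=
    WithConv.toConv (f.comp (HopfAlgebra.antipodeAlgHom K A)) * WithConv.toConv g with hh
  have hmod : (Ideal.Quotient.mkₐ K N).comp h.ofConv =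
      (1 : WithConv (A →ₐ[K] B ⧸ N)).ofConv := by
    rw [hh, AlgHom.comp_convMul_distrib]
    change WithConv.ofConv (WithConv.toConv ((Ideal.Quotient.mkₐ K N).comp
      (f.comp (HopfAlgebra.antipodeAlgHom K A))) *
        WithConv.toConv ((Ideal.Quotient.mkₐ K N).comp g)) = _
    have hfg' : (Ideal.Quotient.mkₐ K N).comp f = (Ideal.Quotient.mkₐ K N).comp g := hfg
    rw [← hfg', ← AlgHom.comp_assoc, toConv_comp_antipode_mul_self]
  have hI : ∀ a ∈ RingHom.ker (Bialgebra.counitAlgHom K A), h.ofConv a ∈ N := by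
    intro a ha
    have := DFunLike.congr_fun hmod a
    rw [← Ideal.Quotient.eq_zero_iff_mem]
    refine Eq.trans this ?_
    have ha0 : counit (R := K) a = 0 := ha
    simp [AlgHom.convOne_def, ha0]
  have hI2 : ∀ a ∈ RingHom.ker (Bialgebra.counitAlgHom K A), h.ofConv a = 0 := by
    intro a ha
    have h1 := Ideal.mem_map_of_mem h.ofConv (augmentationIdeal_le_sq K A ha)
    rw [Ideal.map_pow] at h1
    have h2 : Ideal.map h.ofConv (RingHom.ker (Bialgebra.counitAlgHom K A)) ≤ N :=
      Ideal.map_le_iff_le_comap.2 hI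
    have h3 := Ideal.pow_right_mono h2 2 h1
    rwa [hN] at h3
  have h1 : h = 1 := by
    apply WithConv.ofConv_injective
    ext a
    have := hI2 (a - algebraMap K A (counit a)) (by simp [RingHom.mem_ker])
    rw [map_sub, sub_eq_zero] at this
    rw [this]; simp [AlgHom.convOne_def]
  have h2 : WithConv.toConv f = WithConv.toConv g := by
    rw [← _root_.mul_one (WithConv.toConv f), ← h1, hh, ← _root_.mul_assoc,
      toConv_self_mul_comp_antipode, _root_.one_mul]
  exact WithConv.toConv_injective h2

/-- Finite group schemes over a field of characteristic zero are reduced. -/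
lemma isReduced_of_finite_hopfAlgebra (K A : Type*) [Field K] [CharZero K] [CommRing A]
    [HopfAlgebra K A] [Module.Finite K A] : IsReduced A := by
  have := formallyUnramified_of_finite_hopfAlgebra K A
  exact Algebra.FormallyUnramified.isReduced_of_field K A

end Cartier

/-- An endomorphism of a finite reduced `K`-algebra is determined by its action on the finite set of
geometric points. -/
lemma finite_algHom_of_isReduced (K A : Type*) [Field K] [CommRing A] [Algebra K A]
    [Module.Finite K A] [IsReduced A] : Finite (A →ₐ[K] A) := by
  let L := AlgebraicClosure K
  refine Finite.of_injective
    (fun (f : A →ₐ[K] A) => fun s : A →ₐ[K] L => s.comp f) fun f g hfg => ?_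
  ext a
  rw [← sub_eq_zero]
  have hs : ∀ s : A →ₐ[K] L, s (f a - g a) = 0 := fun s => by
    have := DFunLike.congr_fun (congrFun hfg s) a
    simpa [sub_eq_zero] using this
  by_contra hne
  obtain ⟨p, hp, hmem⟩ : ∃ p : Ideal A, p.IsPrime ∧ f a - g a ∉ p := by
    by_contra! hall
    refine hne (IsReduced.eq_zero _ ?_)
    rw [← mem_nilradical, nilradical_eq_sInf]
    exact Ideal.mem_sInf.2 fun {p} hp => hall p hp
  have : Algebra.IsAlgebraic K (A ⧸ p) := inferInstance
  let s : A ⧸ p →ₐ[K] L := IsAlgClosed.lift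
  have := hs (s.comp (Ideal.Quotient.mkₐ K p))
  have : Function.Injective s := by
    have : IsArtinianRing (A ⧸ p) := .of_finite K _
    have := IsArtinianRing.isField_of_isDomain (A ⧸ p)
    let := this.toField
    exact s.toRingHom.injective
  refine hmem (Ideal.Quotient.eq_zero_iff_mem.1 (this ?_))
  rw [map_zero]
  exact hs (s.comp (Ideal.Quotient.mkₐ K p))

/-! ### Coordinate rings of schemes over an affine base -/

lemma exists_appTop_eq {X Y : Scheme.{u}} [IsAffine Y] (s : Γ(Y, ⊤) ⟶ Γ(X, ⊤)) :
    ∃ g : X ⟶ Y, g.appTop = s := by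
  refine ⟨X.toSpecΓ ≫ Spec.map s ≫ Y.isoSpec.inv, ?_⟩
  have h : Y.isoSpec.inv.appTop ≫ (Scheme.ΓSpecIso Γ(Y, ⊤)).hom = 𝟙 _ := by
    rw [← Scheme.toSpecΓ_appTop, ← Scheme.Hom.comp_appTop, Scheme.toSpecΓ_isoSpec_inv,
      Scheme.Hom.id_appTop]
  rw [Scheme.Hom.comp_appTop, Scheme.Hom.comp_appTop, Scheme.toSpecΓ_appTop, Category.assoc,
    Scheme.ΓSpecIso_naturality, reassoc_of% h]

section Sec

variable {R : Type u} [CommRing R]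

/-- The ring of global sections of a scheme over `Spec R`. -/
def Sec (X : Over (Spec (CommRingCat.of R))) : Type u := Γ(X.left, ⊤)

namespace Sec

noncomputable instance (X : Over (Spec (CommRingCat.of R))) : CommRing (Sec X) :=
  inferInstanceAs (CommRing Γ(X.left, ⊤))

noncomputable instance (X : Over (Spec (CommRingCat.of R))) : Algebra R (Sec X) :=
  ((Scheme.ΓSpecIso (CommRingCat.of R)).inv ≫ X.hom.appTop).hom.toAlgebra

lemma algebraMap_def (X : Over (Spec (CommRingCat.of R))) :
    algebraMap R (Sec X) = ((Scheme.ΓSpecIso (CommRingCat.of R)).inv ≫ X.hom.appTop).hom := rfl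

/-- Pullback of global sections along a morphism of `R`-schemes. -/
noncomputable def map {X Y : Over (Spec (CommRingCat.of R))} (g : X ⟶ Y) : Sec Y →ₐ[R] Sec X where
  __ := g.left.appTop.hom
  commutes' r := by
    have h : ((Scheme.ΓSpecIso (CommRingCat.of R)).inv ≫ Y.hom.appTop) ≫ g.left.appTop =
        (Scheme.ΓSpecIso (CommRingCat.of R)).inv ≫ X.hom.appTop := by
      rw [Category.assoc, ← Scheme.Hom.comp_appTop, Over.w]
    exact congr($h r)

@[simp]
lemma map_comp_apply {X Y Z : Over (Spec (CommRingCat.of R))} (g : X ⟶ Y) (h : Y ⟶ Z)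
    (z : Sec Z) : map (g ≫ h) z = map g (map h z) := by
  have := Scheme.Hom.comp_appTop g.left h.left
  exact congr($this z)

@[simp]
lemma map_id_apply {X : Over (Spec (CommRingCat.of R))} (x : Sec X) : map (𝟙 X) x = x := by
  have := Scheme.Hom.id_appTop (X := X.left)
  exact congr($this x)

variable {X Y : Over (Spec (CommRingCat.of R))}

lemma hom_ext [IsAffine Y.left] {g h : X ⟶ Y} (e : ∀ y, map g y = map h y) : g = h := by
  ext1
  refine ext_of_isAffine ?_
  ext y
  exact e y

lemma exists_hom [IsAffine Y.left] (s : Sec Y →ₐ[R] Sec X) : ∃ g : X ⟶ Y, map g = s := by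
  obtain ⟨g, hg⟩ := exists_appTop_eq
    (CommRingCat.ofHom (R := Γ(Y.left, ⊤)) (S := Γ(X.left, ⊤)) s.toRingHom)
  refine ⟨Over.homMk g ?_, ?_⟩
  · refine ext_of_isAffine ?_
    rw [Scheme.Hom.comp_appTop, hg, ← cancel_epi (Scheme.ΓSpecIso (CommRingCat.of R)).inv]
    ext r
    exact s.commutes r
  · ext y
    exact congr($hg y)

lemma isIso_of_bijective [IsAffine X.left] [IsAffine Y.left] (g : X ⟶ Y)
    (hg : Function.Bijective (map g)) : IsIso g := by
  let e := AlgEquiv.ofBijective (map g) hg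
  obtain ⟨h, hh⟩ := exists_hom (e.symm : Sec X →ₐ[R] Sec Y)
  refine ⟨h, hom_ext fun y => ?_, hom_ext fun y => ?_⟩
  · rw [map_comp_apply, hh, map_id_apply]; exact e.apply_symm_apply y
  · rw [map_comp_apply, hh, map_id_apply]; exact e.symm_apply_apply y

lemma bijective_of_isIso (g : X ⟶ Y) [IsIso g] : Function.Bijective (map g) := by
  refine Function.bijective_iff_has_inverse.2 ⟨map (inv g), fun y => ?_, fun y => ?_⟩
  · rw [← map_comp_apply, IsIso.inv_hom_id, map_id_apply]
  · rw [← map_comp_apply, IsIso.hom_inv_id, map_id_apply]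

lemma isAffine_of_isFinite (X : Over (Spec (CommRingCat.of R))) [IsFinite X.hom] :
    IsAffine X.left := isAffine_of_isAffineHom X.hom

lemma algebraMap_finite [IsFinite X.hom] : Module.Finite R (Sec X) := by
  have : IsAffine X.left := isAffine_of_isFinite X
  have h1 : X.hom.appTop.hom.Finite := Scheme.Hom.finite_app X.hom ⊤ (isAffineOpen_top _)
  have h2 : (algebraMap R (Sec X)).Finite := by
    rw [algebraMap_def, CommRingCat.hom_comp]
    exact h1.comp (RingHom.Finite.of_surjective _
      (ConcreteCategory.bijective_of_isIso (Scheme.ΓSpecIso (CommRingCat.of R)).inv).2)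
  exact RingHom.finite_algebraMap.1 h2

lemma flat [IsAffine X.left] [Flat X.hom] : Module.Flat R (Sec X) := by
  have h1 : X.hom.appTop.hom.Flat := Scheme.Hom.flat_appTop X.hom
  have h2 : (algebraMap R (Sec X)).Flat := by
    rw [algebraMap_def, CommRingCat.hom_comp]
    exact RingHom.Flat.comp (RingHom.Flat.of_bijective
      (ConcreteCategory.bijective_of_isIso (Scheme.ΓSpecIso (CommRingCat.of R)).inv)) h1
  exact h2

/-- Every finite flat `R`-algebra is the coordinate ring of a finite flat `R`-scheme. -/
lemma exists_over (B : Type u) [CommRing B] [Algebra R B] [Module.Finite R B] [Module.Flat R B] :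
    ∃ Q : Over (Spec (CommRingCat.of R)),
      IsFinite Q.hom ∧ Flat Q.hom ∧ Nonempty (Sec Q ≃ₐ[R] B) := by
  refine ⟨Over.mk (specMap R B), ?_, ?_, ⟨?_⟩⟩
  · exact (IsFinite.SpecMap_iff _).2 (RingHom.finite_algebraMap.2 inferInstance)
  · exact (HasRingHomProperty.Spec_iff (P := @Flat)).2 (RingHom.flat_algebraMap_iff.2 ‹_›)
  · refine AlgEquiv.ofRingEquiv
      (f := (Scheme.ΓSpecIso (CommRingCat.of B)).commRingCatIsoToRingEquiv) fun r => ?_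
    have h := Scheme.ΓSpecIso_inv_naturality (CommRingCat.ofHom (algebraMap R B))
    have h' : ((Scheme.ΓSpecIso (CommRingCat.of R)).inv ≫ (specMap R B).appTop) ≫
        (Scheme.ΓSpecIso (CommRingCat.of B)).hom = CommRingCat.ofHom (algebraMap R B) := by
      rw [← h, Category.assoc, Iso.inv_hom_id, Category.comp_id]
    exact congr($h' r)

end Sec

end Sec

/-! ### Saturated morphisms and generic isomorphisms -/

section Saturated

variable {R : Type u} [CommRing R] {X Y Z W : Over (Spec (CommRingCat.of R))}

/-- A morphism `t : X ⟶ Y` of `R`-schemes is a generic isomorphism if it is injective with torsion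
cokernel on global sections. -/
structure GenericIso (t : X ⟶ Y) : Prop where
  injective : Function.Injective (Sec.map t)
  exists_smul : ∀ x : Sec X, ∃ r : R, r ≠ 0 ∧ ∃ y : Sec Y, Sec.map t y = r • x

/-- A morphism `q : X ⟶ Y` of `R`-schemes is saturated if it is injective with torsion-free cokernel
on global sections. -/
structure Saturated (q : X ⟶ Y) : Prop where
  injective : Function.Injective (Sec.map q)
  mem_range : ∀ (r : R) (x : Sec X), r ≠ 0 → r • x ∈ (Sec.map q).range → x ∈ (Sec.map q).range

lemma exists_algHom_comp_eq {A B C : Type*} [CommRing A] [CommRing B] [CommRing C] [Algebra R A]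
    [Algebra R B] [Algebra R C] (f : A →ₐ[R] C) {g : B →ₐ[R] C} (hg : Function.Injective g)
    (h : ∀ a, f a ∈ g.range) : ∃ s : A →ₐ[R] B, ∀ a, g (s a) = f a := by
  refine ⟨(AlgEquiv.ofInjective g hg).symm.toAlgHom.comp (f.codRestrict g.range h), fun a => ?_⟩
  exact congrArg Subtype.val
    ((AlgEquiv.ofInjective g hg).apply_symm_apply (f.codRestrict g.range h a))

/-- Saturated morphisms have the left lifting property against generic isomorphisms. -/
lemma Saturated.exists_lift [IsAffine Z.left] [IsAffine W.left] {q : X ⟶ Y} (hq : Saturated q)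
    {t : Z ⟶ W} (ht : GenericIso t) {k : Y ⟶ W} {l : X ⟶ Z} (h : q ≫ k = l ≫ t) :
    ∃ g : Y ⟶ Z, q ≫ g = l ∧ g ≫ t = k := by
  obtain ⟨s, hs⟩ := exists_algHom_comp_eq (Sec.map l) hq.injective fun z => by
    obtain ⟨r, hr, w, hw⟩ := ht.exists_smul z
    refine hq.mem_range r _ hr ⟨Sec.map k w, ?_⟩
    rw [← map_smul, ← hw]
    change Sec.map q (Sec.map k w) = _
    rw [← Sec.map_comp_apply, ← Sec.map_comp_apply, h]
  obtain ⟨g, rfl⟩ := Sec.exists_hom s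
  refine ⟨g, Sec.hom_ext fun z => ?_, Sec.hom_ext fun w => hq.injective ?_⟩
  · rw [Sec.map_comp_apply, hs]
  · rw [Sec.map_comp_apply, hs, ← Sec.map_comp_apply, ← Sec.map_comp_apply, h]

lemma eq_of_smul_eq_smul [IsDomain R] [IsAffine X.left] [Flat X.hom] {r : R} (hr : r ≠ 0)
    {x y : Sec X} (h : r • x = r • y) : x = y := by
  have := Sec.flat (X := X)
  exact Module.Flat.isSMulRegular_of_nonZeroDivisors (mem_nonZeroDivisors_of_ne_zero hr) h

/-- Generic isomorphisms are monomorphisms with respect to flat affine schemes. -/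
lemma GenericIso.hom_ext [IsDomain R] [IsAffine X.left] [Flat X.hom] [IsAffine Z.left]
    {t : Z ⟶ W} (ht : GenericIso t) {x y : X ⟶ Z} (h : x ≫ t = y ≫ t) : x = y := by
  refine Sec.hom_ext fun z => ?_
  obtain ⟨r, hr, w, hw⟩ := ht.exists_smul z
  refine eq_of_smul_eq_smul hr ?_
  rw [← map_smul, ← map_smul, ← hw, ← Sec.map_comp_apply, ← Sec.map_comp_apply, h]

lemma GenericIso.iso_comp {t : Z ⟶ W} (ht : GenericIso t) (i : X ≅ Z) :
    GenericIso (i.hom ≫ t) where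
  injective := by
    have : (Sec.map (i.hom ≫ t) : Sec W → Sec X) = Sec.map i.hom ∘ Sec.map t :=
      funext fun z => Sec.map_comp_apply i.hom t z
    rw [this]
    exact (Sec.bijective_of_isIso i.hom).1.comp ht.injective
  exists_smul x := by
    obtain ⟨z, rfl⟩ := (Sec.bijective_of_isIso i.hom).2 x
    obtain ⟨r, hr, w, hw⟩ := ht.exists_smul z
    exact ⟨r, hr, w, by rw [Sec.map_comp_apply, hw, map_smul]⟩

lemma Saturated.comp {q : X ⟶ Y} {q' : Y ⟶ Z} (hq : Saturated q) (hq' : Saturated q') :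
    Saturated (q ≫ q') where
  injective := by
    have : (Sec.map (q ≫ q') : Sec Z → Sec X) = Sec.map q ∘ Sec.map q' :=
      funext fun z => Sec.map_comp_apply q q' z
    rw [this]
    exact hq.injective.comp hq'.injective
  mem_range r x hr := by
    rintro ⟨z, hz : Sec.map (q ≫ q') z = r • x⟩
    rw [Sec.map_comp_apply] at hz
    obtain ⟨y, rfl⟩ := hq.mem_range r x hr ⟨_, hz⟩
    change _ = r • Sec.map q y at hz
    rw [← map_smul] at hz
    obtain ⟨z', rfl⟩ := hq'.mem_range r y hr ⟨z, hq.injective hz⟩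
    exact ⟨z', Sec.map_comp_apply q q' z'⟩

lemma Saturated.of_isIso (q : X ⟶ Y) [IsIso q] : Saturated q where
  injective := (Sec.bijective_of_isIso q).1
  mem_range _ x _ _ := (Sec.bijective_of_isIso q).2 x

section

open TensorProduct

/-- Torsion-freeness of a cokernel is preserved by flat base change. -/
lemma mem_range_includeLeft_of_smul_mem {A B C : Type*} [CommRing A] [CommRing B] [CommRing C]
    [Algebra A B] [Algebra A C] [Module.Flat A B] {r : A}
    (hr : ∀ c : C, r • c ∈ (Algebra.linearMap A C).range → c ∈ (Algebra.linearMap A C).range)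
    {x : B ⊗[A] C} {b : B} (hx : r • x = b ⊗ₜ 1) : ∃ b' : B, x = b' ⊗ₜ 1 := by
  let N := C ⧸ (Algebra.linearMap A C).range
  have hinj : Function.Injective (LinearMap.lsmul A N r) := by
    rw [← LinearMap.ker_eq_bot, LinearMap.ker_eq_bot']
    intro n hn
    obtain ⟨c, rfl⟩ := Submodule.Quotient.mk_surjective _ n
    rw [LinearMap.lsmul_apply, ← Submodule.Quotient.mk_smul, Submodule.Quotient.mk_eq_zero] at hn
    exact (Submodule.Quotient.mk_eq_zero _).2 (hr c hn)
  have hinj' := Module.Flat.lTensor_preserves_injective_linearMap (M := B) _ hinj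
  have hex : Function.Exact ((Algebra.linearMap A C).lTensor B)
      ((Algebra.linearMap A C).range.mkQ.lTensor B) :=
    lTensor_exact B (LinearMap.exact_map_mkQ_range _) (Submodule.mkQ_surjective _)
  have hb : b ⊗ₜ 1 = (Algebra.linearMap A C).lTensor B (b ⊗ₜ 1) := by simp
  have hx0 : (Algebra.linearMap A C).range.mkQ.lTensor B x = 0 := by
    refine hinj' ?_
    rw [map_zero]
    have h1 : (Algebra.linearMap A C).range.mkQ.lTensor B (r • x) = 0 := by
      rw [hx, hb]; exact hex.apply_apply_eq_zero _
    rw [← h1, map_smul]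
    have h2 : (LinearMap.lsmul A N r) = r • LinearMap.id := rfl
    rw [h2, LinearMap.lTensor_smul, LinearMap.lTensor_id]; rfl
  obtain ⟨y, rfl⟩ := (hex x).1 hx0
  refine ⟨TensorProduct.rid A B y, ?_⟩
  clear hx hx0
  induction y with
  | zero => simp
  | add y z hy hz => simp only [map_add, hy, hz, TensorProduct.add_tmul]
  | tmul b a => simp [TensorProduct.smul_tmul, Algebra.algebraMap_eq_smul_one]

end

/-- Saturated morphisms of affine schemes are stable under flat base change. -/
lemma Saturated.of_isPullback {a : Z ⟶ W} {b : Z ⟶ X} {p : W ⟶ Y} {q : X ⟶ Y}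
    [IsAffine X.left] [IsAffine Y.left] [IsAffine W.left] [Flat p.left]
    (h : IsPullback a.left b.left p.left q.left) (hq : Saturated q) : Saturated a := by
  have hpush := isPushout_appTop_of_isPullback h
  have hflat : p.left.appTop.hom.Flat := Scheme.Hom.flat_appTop p.left
  have hw : a ≫ p = b ≫ q := by ext1; exact h.w
  let : Algebra (Sec Y) (Sec W) := (Sec.map p).toRingHom.toAlgebra
  let : Algebra (Sec Y) (Sec X) := (Sec.map q).toRingHom.toAlgebra
  let : Algebra (Sec W) (Sec Z) := (Sec.map a).toRingHom.toAlgebra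
  let : Algebra (Sec X) (Sec Z) := (Sec.map b).toRingHom.toAlgebra
  let : Algebra (Sec Y) (Sec Z) := (Sec.map (a ≫ p)).toRingHom.toAlgebra
  have : IsScalarTower (Sec Y) (Sec W) (Sec Z) :=
    .of_algebraMap_eq fun y => Sec.map_comp_apply a p y
  have : IsScalarTower (Sec Y) (Sec X) (Sec Z) :=
    .of_algebraMap_eq fun y => by
      change Sec.map (a ≫ p) y = _
      rw [hw]; exact Sec.map_comp_apply b q y
  have : Module.Flat (Sec Y) (Sec W) := hflat
  have hP : Algebra.IsPushout (Sec Y) (Sec W) (Sec X) (Sec Z) :=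
    CommRingCat.isPushout_iff_isPushout.1 hpush
  let e := Algebra.IsPushout.equiv (Sec Y) (Sec W) (Sec X) (Sec Z)
  have he (w : Sec W) : e (w ⊗ₜ 1) = Sec.map a w := by
    rw [Algebra.IsPushout.equiv_tmul, map_one, _root_.mul_one]; rfl
  have hinj : Function.Injective (Sec.map a) := by
    intro w w' hww
    rw [← he, ← he] at hww
    have h1 := e.injective hww
    refine Algebra.TensorProduct.includeLeft_injective (R := Sec Y) (A := Sec W) (B := Sec X)
      (S := Sec Y) hq.injective h1
  refine ⟨hinj, fun r z hr => ?_⟩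
  rintro ⟨w, hw' : Sec.map a w = r • z⟩
  obtain ⟨w', hw''⟩ := mem_range_includeLeft_of_smul_mem (A := Sec Y) (B := Sec W) (C := Sec X)
    (r := algebraMap R (Sec Y) r) (x := e.symm z) (b := w) (fun c => by
      have hc : algebraMap R (Sec Y) r • c = r • c := by
        rw [Algebra.smul_def, Algebra.smul_def]
        exact congrArg (· * c) ((Sec.map q).commutes r)
      rw [hc]
      exact hq.mem_range r c hr) (e.injective (by
      rw [he, hw', Algebra.smul_def, Algebra.smul_def, map_mul, e.apply_symm_apply]
      refine congrArg (· * z) ?_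
      rw [IsScalarTower.algebraMap_apply (Sec Y) (Sec W), Algebra.TensorProduct.algebraMap_apply,
        he]
      exact ((Sec.map p).commutes r ▸ (Sec.map a).commutes r)))
  exact ⟨w', by rw [← e.apply_symm_apply z, hw'', he]; rfl⟩

section

variable [IsAffine X.left] [IsAffine Y.left] [IsAffine Z.left] [Flat Z.hom]

lemma Saturated.whiskerRight {q : X ⟶ Y} (hq : Saturated q) : Saturated (q ▷ Z) := by
  have h1 : IsPullback (pullback.fst Y.hom Z.hom) (pullback.snd Y.hom Z.hom) Y.hom Z.hom :=
    IsPullback.of_hasPullback _ _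
  have h2 : IsPullback (pullback.fst X.hom Z.hom) ((q ▷ Z).left ≫ pullback.snd Y.hom Z.hom)
      (q.left ≫ Y.hom) Z.hom := by
    rw [Over.whiskerRight_left_snd, Over.w q]
    exact IsPullback.of_hasPullback _ _
  have h3 := IsPullback.of_right h2.flip (Over.whiskerRight_left_fst q) h1.flip
  have : Flat (fst Y Z).left := inferInstanceAs (Flat (pullback.fst Y.hom Z.hom))
  have : IsAffine (Y ⊗ Z).left := inferInstanceAs (IsAffine (pullback Y.hom Z.hom))
  exact Saturated.of_isPullback (b := fst X Z) (p := fst Y Z) h3 hq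

lemma Saturated.whiskerLeft {q : X ⟶ Y} (hq : Saturated q) : Saturated (Z ◁ q) := by
  have h : Z ◁ q = (β_ Z X).hom ≫ q ▷ Z ≫ (β_ Y Z).hom := by simp
  rw [h]
  exact (Saturated.of_isIso _).comp (hq.whiskerRight.comp (.of_isIso _))

end

lemma Saturated.tensorHom_self {q : X ⟶ Y} (hq : Saturated q) [IsAffine X.left] [IsAffine Y.left]
    [Flat X.hom] [Flat Y.hom] : Saturated (q ⊗ₘ q) := by
  rw [MonoidalCategory.tensorHom_def]
  exact hq.whiskerRight.comp hq.whiskerLeft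

end Saturated

/-! ### The generic fibre -/

section GenericFibre

variable {R : Type u} (K : Type u) [CommRing R] [Field K] [Algebra R K]
  {X Y Z : Over (Spec (CommRingCat.of R))}

/-- The generic fibre `X_K` of an `R`-scheme `X`, regarded as an `R`-scheme. -/
noncomputable def genericFibre (X : Over (Spec (CommRingCat.of R))) :
    Over (Spec (CommRingCat.of R)) :=
  (Over.map (specMap R K)).obj ((Over.pullback (specMap R K)).obj X)

/-- The projection of the generic fibre of `X` to `X`. -/
noncomputable def genericFibreι (X : Over (Spec (CommRingCat.of R))) : genericFibre K X ⟶ X :=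
  (Over.mapPullbackAdj (specMap R K)).counit.app X

lemma genericFibreι_left (X : Over (Spec (CommRingCat.of R))) :
    (genericFibreι K X).left = pullback.fst X.hom (specMap R K) := by
  rw [genericFibreι, Over.mapPullbackAdj_counit_app]
  rfl

variable {K}

/-- A morphism of generic fibres, regarded as a morphism of `R`-schemes. -/
noncomputable def genericMap (ψ : (Over.pullback (specMap R K)).obj X ⟶
    (Over.pullback (specMap R K)).obj Y) : genericFibre K X ⟶ genericFibre K Y :=
  (Over.map (specMap R K)).map ψ

lemma genericMap_comp (ψ : (Over.pullback (specMap R K)).obj X ⟶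
    (Over.pullback (specMap R K)).obj Y) (ψ' : (Over.pullback (specMap R K)).obj Y ⟶
    (Over.pullback (specMap R K)).obj Z) :
    genericMap (ψ ≫ ψ') = genericMap ψ ≫ genericMap ψ' :=
  (Over.map (specMap R K)).map_comp ψ ψ'

lemma genericMap_map_comp_ι (g : X ⟶ Y) :
    genericMap ((Over.pullback (specMap R K)).map g) ≫ genericFibreι K Y =
      genericFibreι K X ≫ g :=
  (Over.mapPullbackAdj (specMap R K)).counit.naturality g

lemma eq_of_genericMap_comp_ι_eq {ψ ψ' : (Over.pullback (specMap R K)).obj X ⟶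
    (Over.pullback (specMap R K)).obj Y}
    (h : genericMap ψ ≫ genericFibreι K Y = genericMap ψ' ≫ genericFibreι K Y) : ψ = ψ' := by
  refine ((Over.mapPullbackAdj (specMap R K)).homEquiv _ _).symm.injective ?_
  rw [Adjunction.homEquiv_counit, Adjunction.homEquiv_counit]
  exact h

lemma isIso_of_isIso_genericMap {ψ : (Over.pullback (specMap R K)).obj X ⟶
    (Over.pullback (specMap R K)).obj Y} [IsIso (genericMap ψ)] : IsIso ψ := by
  have : IsIso ((Over.forget (Spec (CommRingCat.of K))).map ψ) :=
    inferInstanceAs (IsIso ((Over.forget _).map (genericMap ψ)))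
  exact isIso_of_reflects_iso ψ (Over.forget _)

instance [IsAffine X.left] : IsAffine (genericFibre K X).left :=
  inferInstanceAs (IsAffine (pullback X.hom (specMap R K)))

variable [IsFractionRing R K]

open nonZeroDivisors in
/-- The coordinate ring of the generic fibre is the localization of the coordinate ring at the
nonzero elements of `R`. -/
lemma isLocalization_genericFibre [IsAffine X.left] :
    letI := (Sec.map (genericFibreι K X)).toRingHom.toAlgebra
    IsLocalization (Algebra.algebraMapSubmonoid (Sec X) R⁰) (Sec (genericFibre K X)) := by
  let : Algebra (Sec X) (Sec (genericFibre K X)) :=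
    (Sec.map (genericFibreι K X)).toRingHom.toAlgebra
  have hp := isPushout_appTop_of_isPullback (IsPullback.of_hasPullback X.hom (specMap R K))
  let eK := (Scheme.ΓSpecIso (CommRingCat.of K)).inv ≫
    (pullback.snd X.hom (specMap R K)).appTop
  let : Algebra K (Sec (genericFibre K X)) :=
    RingHom.toAlgebra (S := Γ(pullback X.hom (specMap R K), ⊤)) eK.hom
  have : IsScalarTower R (Sec X) (Sec (genericFibre K X)) :=
    .of_algebraMap_eq fun r => ((Sec.map (genericFibreι K X)).commutes r).symm
  have hnat := Scheme.ΓSpecIso_inv_naturality (CommRingCat.ofHom (algebraMap R K))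
  have : IsScalarTower R K (Sec (genericFibre K X)) :=
    .of_algebraMap_eq fun r => by
      have hw : (genericFibre K X).hom = pullback.snd X.hom (specMap R K) ≫ specMap R K := rfl
      have h : (Scheme.ΓSpecIso (CommRingCat.of R)).inv ≫ (genericFibre K X).hom.appTop =
          CommRingCat.ofHom (algebraMap R K) ≫ eK := by
        rw [hw, Scheme.Hom.comp_appTop, reassoc_of% hnat]
        rfl
      exact congr($h r)
  have hP : Algebra.IsPushout R (Sec X) K (Sec (genericFibre K X)) := by
    refine CommRingCat.isPushout_iff_isPushout.1 ?_
    refine hp.of_iso (Scheme.ΓSpecIso (CommRingCat.of R)) (Iso.refl _)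
      (Scheme.ΓSpecIso (CommRingCat.of K)) (Iso.refl _) ?_ ?_ ?_ ?_
    · exact (Category.comp_id _).trans
        ((Scheme.ΓSpecIso (CommRingCat.of R)).hom_inv_id_assoc _).symm
    · exact Scheme.ΓSpecIso_naturality (CommRingCat.ofHom (algebraMap R K))
    · refine (Category.comp_id _).trans (Eq.trans ?_ (Category.id_comp _).symm)
      exact congrArg Scheme.Hom.appTop (genericFibreι_left K X).symm
    · exact (Category.comp_id _).trans
        ((Scheme.ΓSpecIso (CommRingCat.of K)).hom_inv_id_assoc _).symm
  exact (Algebra.isLocalization_iff_isPushout R⁰ K).2 hP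

variable [IsDomain R]

lemma isUnit_algebraMap_genericFibre (X : Over (Spec (CommRingCat.of R))) {r : R} (hr : r ≠ 0)
    [IsAffine X.left] : IsUnit (algebraMap R (Sec (genericFibre K X)) r) := by
  let := (Sec.map (genericFibreι K X)).toRingHom.toAlgebra
  have := isLocalization_genericFibre (K := K) (X := X)
  have h := IsLocalization.map_units (Sec (genericFibre K X))
    (⟨algebraMap R (Sec X) r, r, mem_nonZeroDivisors_of_ne_zero hr, rfl⟩ :
      Algebra.algebraMapSubmonoid (Sec X) (nonZeroDivisors R))
  have h2 : algebraMap (Sec X) (Sec (genericFibre K X)) (algebraMap R (Sec X) r) =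
    algebraMap R (Sec (genericFibre K X)) r := (Sec.map (genericFibreι K X)).commutes r
  rwa [← h2]

lemma genericFibre_smul_cancel [IsAffine X.left] {r : R} (hr : r ≠ 0)
    {x y : Sec (genericFibre K X)} (h : r • x = r • y) : x = y := by
  rw [Algebra.smul_def, Algebra.smul_def] at h
  exact (isUnit_algebraMap_genericFibre X hr).mul_right_injective h

lemma genericFibre_exists_smul [IsAffine X.left] (x : Sec (genericFibre K X)) :
    ∃ r : R, r ≠ 0 ∧ ∃ y, Sec.map (genericFibreι K X) y = r • x := by
  let := (Sec.map (genericFibreι K X)).toRingHom.toAlgebra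
  have := isLocalization_genericFibre (K := K) (X := X)
  obtain ⟨⟨y, ⟨_, r, hr, rfl⟩⟩, h⟩ := IsLocalization.surj
    (Algebra.algebraMapSubmonoid (Sec X) (nonZeroDivisors R)) x
  refine ⟨r, nonZeroDivisors.ne_zero hr, y, ?_⟩
  refine h.symm.trans ?_
  rw [Algebra.smul_def, _root_.mul_comm]
  exact congrArg (· * x) ((Sec.map (genericFibreι K X)).commutes r)

lemma map_genericFibreι_injective [IsAffine X.left] [Flat X.hom] :
    Function.Injective (Sec.map (genericFibreι K X)) := by
  let := (Sec.map (genericFibreι K X)).toRingHom.toAlgebra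
  have := isLocalization_genericFibre (K := K) (X := X)
  refine IsLocalization.injective (M := Algebra.algebraMapSubmonoid (Sec X) (nonZeroDivisors R))
    (Sec (genericFibre K X)) ?_
  rintro _ ⟨r, hr, rfl⟩
  rw [mem_nonZeroDivisors_iff_right]
  intro x hx
  refine eq_of_smul_eq_smul (nonZeroDivisors.ne_zero hr) ?_
  rw [smul_zero, Algebra.smul_def, _root_.mul_comm, hx]

/-- Passage to the generic fibre is faithful on flat affine `R`-schemes. -/
lemma hom_ext_genericFibre [IsAffine X.left] [Flat X.hom] [IsAffine Y.left] {g h : X ⟶ Y}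
    (e : (Over.pullback (specMap R K)).map g = (Over.pullback (specMap R K)).map h) : g = h := by
  refine Sec.hom_ext fun y => map_genericFibreι_injective (K := K) ?_
  rw [← Sec.map_comp_apply, ← Sec.map_comp_apply, ← genericMap_map_comp_ι, e,
    genericMap_map_comp_ι]

/-- The restriction of a generic isomorphism to the generic fibres is an isomorphism. -/
lemma GenericIso.isIso_map [IsAffine X.left] [IsAffine Y.left] [Flat X.hom] {t : X ⟶ Y}
    (ht : GenericIso t) : IsIso ((Over.pullback (specMap R K)).map t) := by
  have key (y : Sec Y) : Sec.map (genericMap ((Over.pullback (specMap R K)).map t))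
      (Sec.map (genericFibreι K Y) y) = Sec.map (genericFibreι K X) (Sec.map t y) := by
    rw [← Sec.map_comp_apply, ← Sec.map_comp_apply, genericMap_map_comp_ι]
  have : IsIso (genericMap ((Over.pullback (specMap R K)).map t)) := by
    refine Sec.isIso_of_bijective _ ⟨?_, fun x => ?_⟩
    · rw [injective_iff_map_eq_zero]
      intro z hz
      obtain ⟨r, hr, y, hy⟩ := genericFibre_exists_smul z
      have h0 : Sec.map (genericFibreι K X) (Sec.map t y) = 0 := by
        rw [← key, hy, map_smul, hz, smul_zero]
      have hy0 : y = 0 := ht.injective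
        ((map_genericFibreι_injective (h0.trans (map_zero _).symm)).trans (map_zero _).symm)
      refine genericFibre_smul_cancel hr ?_
      rw [← hy, hy0, map_zero, smul_zero]
    · obtain ⟨r, hr, x', hx'⟩ := genericFibre_exists_smul x
      obtain ⟨r', hr', y, hy⟩ := ht.exists_smul x'
      obtain ⟨c, hc⟩ := isUnit_algebraMap_genericFibre (K := K) Y (mul_ne_zero hr hr')
      refine ⟨(c⁻¹ : (Sec (genericFibre K Y))ˣ) * Sec.map (genericFibreι K Y) y, ?_⟩
      refine genericFibre_smul_cancel (mul_ne_zero hr hr') ?_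
      rw [← map_smul, Algebra.smul_def, ← hc, ← _root_.mul_assoc, Units.mul_inv, _root_.one_mul,
        key, hy, map_smul, hx', smul_smul, _root_.mul_comm]
  exact isIso_of_isIso_genericMap

end GenericFibre

/-! ### Endomorphisms of finite group schemes in characteristic zero -/

/-- The coordinate ring of a finite group scheme over a field of characteristic zero is a finite
reduced algebra, which has only finitely many endomorphisms. -/
lemma finite_hom_self_of_isFinite {K : Type u} [Field K] [CharZero K]
    (N : GroupScheme (Spec (CommRingCat.of K))) [IsFinite N.X.hom] : Finite (N.X ⟶ N.X) := by
  have : IsAffine N.X.left := Sec.isAffine_of_isFinite N.X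
  obtain ⟨A, ⟨i⟩⟩ := (essImage_hopfSpec (R := CommRingCat.of K) (G := N.toGrp)).2 this
  let j : (algSpec (CommRingCat.of K)).obj (.op (.of K A.unop)) ≅ N.X := (Grp.forget _).mapIso i
  have hfin : IsFinite ((algSpec (CommRingCat.of K)).obj (.op (.of K A.unop))).hom := by
    rw [← Over.w j.hom]
    have : IsIso j.hom.left := inferInstanceAs (IsIso ((Over.forget _).map j.hom))
    exact MorphismProperty.comp_mem @IsFinite _ _ inferInstance ‹_›
  have : Module.Finite K A.unop := by
    exact RingHom.finite_algebraMap.1 ((IsFinite.SpecMap_iff _).1 hfin)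
  have := isReduced_of_finite_hopfAlgebra K A.unop
  have := finite_algHom_of_isReduced K A.unop
  refine Finite.of_injective (fun g : N.X ⟶ N.X =>
    (((algSpec.fullyFaithful (R := CommRingCat.of K)).preimage
      (j.hom ≫ g ≫ j.inv)).unop.hom : A.unop →ₐ[K] A.unop)) fun g h hgh => ?_
  have h1 := congrArg (algSpec (CommRingCat.of K)).map
    (Quiver.Hom.unop_inj (CommAlgCat.hom_ext hgh))
  rw [Functor.FullyFaithful.map_preimage, Functor.FullyFaithful.map_preimage] at h1
  simpa using h1

section

variable {R : Type u} (K : Type u) [CommRing R] [IsDomain R] [Field K] [CharZero K] [Algebra R K]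
  [IsFractionRing R K]

/-- An endomorphism `s` of a finite flat scheme underlying a group scheme is an isomorphism if it is
one on the generic fibre: the generic fibre has finitely many endomorphisms, so some power of `s` is
the identity on it, and then is the identity. -/
lemma isIso_of_isIso_map (G : GroupScheme (Spec (CommRingCat.of R))) [IsFinite G.X.hom]
    [Flat G.X.hom] (s : G.X ⟶ G.X) [IsIso ((Over.pullback (specMap R K)).map s)] : IsIso s := by
  have : IsAffine G.X.left := Sec.isAffine_of_isFinite G.X
  let N := (baseChange (specMap R K)).obj G
  have : IsFinite N.X.hom := inferInstanceAs (IsFinite (pullback.snd G.X.hom (specMap R K)))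
  have := finite_hom_self_of_isFinite N
  let τ : End N.X := (Over.pullback (specMap R K)).mapEnd G.X (End.of s)
  have : Finite (End N.X) := finite_hom_self_of_isFinite N
  have hτ : IsUnit τ := (isUnit_iff_isIso _).2 ‹_›
  obtain ⟨u, hu⟩ := hτ
  obtain ⟨n, hn, hn1⟩ := isOfFinOrder_iff_pow_eq_one.1 (isOfFinOrder_of_finite u)
  have hτn : τ ^ n = 1 := by rw [← hu, ← Units.val_pow_eq_pow_val, hn1, Units.val_one]
  have hone : (End.of s) ^ n = 1 := by
    refine hom_ext_genericFibre (K := K) ?_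
    have h1 := map_pow ((Over.pullback (specMap R K)).mapEnd G.X) (End.of s) n
    have h2 := map_one ((Over.pullback (specMap R K)).mapEnd G.X)
    exact (h1.trans hτn).trans h2.symm
  exact (isUnit_iff_isIso (End.of s)).1 (IsUnit.of_pow_eq_one hone hn.ne')

end

/-! ### Models of the generic fibre -/

section Models

variable {R : Type u} [CommRing R] [IsDedekindDomain R] {X Y P : Over (Spec (CommRingCat.of R))}

/-- A finite flat algebra `B` that contains the coordinate ring of `Y` with torsion cokernel is the
coordinate ring of a finite flat scheme `Q` generically isomorphic to `Y`. -/
lemma exists_genericIso {R : Type u} [CommRing R] {Y : Over (Spec (CommRingCat.of R))}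
    [IsAffine Y.left] (B : Type u) [CommRing B] [Algebra R B] [Module.Finite R B]
    [Module.Flat R B] {σ : Sec Y →ₐ[R] B} (hσ : Function.Injective σ)
    (h : ∀ b, ∃ r : R, r ≠ 0 ∧ ∃ y, σ y = r • b) :
    ∃ (Q : Over (Spec (CommRingCat.of R))) (e : Sec Q ≃ₐ[R] B) (t : Q ⟶ Y),
      IsFinite Q.hom ∧ Flat Q.hom ∧ GenericIso t ∧ ∀ y, e (Sec.map t y) = σ y := by
  obtain ⟨Q, hQ, hQ', ⟨e⟩⟩ := Sec.exists_over (R := R) B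
  obtain ⟨t, ht⟩ := Sec.exists_hom ((e.symm : B →ₐ[R] Sec Q).comp σ)
  have het (y) : e (Sec.map t y) = σ y := by rw [ht]; exact e.apply_symm_apply _
  refine ⟨Q, e, t, hQ, hQ', ⟨?_, fun x => ?_⟩, het⟩
  · rw [ht]; exact e.symm.injective.comp hσ
  · obtain ⟨r, hr, y, hy⟩ := h (e x)
    exact ⟨r, hr, y, e.injective (by rw [het, hy, map_smul])⟩

/-- The elements of an algebra having a nonzero multiple in a given subalgebra. -/
def saturation {C : Type*} [CommRing C] [Algebra R C] (A : Subalgebra R C) : Subalgebra R C where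
  carrier := {c | ∃ r : R, r ≠ 0 ∧ r • c ∈ A}
  mul_mem' := by
    rintro a b ⟨r, hr, ha⟩ ⟨s, hs, hb⟩
    exact ⟨r * s, mul_ne_zero hr hs, by rw [← smul_mul_smul_comm]; exact A.mul_mem ha hb⟩
  add_mem' := by
    rintro a b ⟨r, hr, ha⟩ ⟨s, hs, hb⟩
    refine ⟨r * s, mul_ne_zero hr hs, ?_⟩
    rw [smul_add, mul_smul r s b, _root_.mul_comm r s, mul_smul s r a]
    exact A.add_mem (A.smul_mem ha s) (A.smul_mem hb r)
  algebraMap_mem' r := ⟨1, one_ne_zero, A.smul_mem (A.algebraMap_mem r) 1⟩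

/-- Every morphism of finite flat schemes that is injective on functions is a saturated morphism
followed by a generic isomorphism. -/
lemma exists_saturated_genericIso_factorization [IsFinite X.hom] [Flat X.hom] [IsAffine Y.left]
    (w : X ⟶ Y) (hw : Function.Injective (Sec.map w)) :
    ∃ (Q : Over (Spec (CommRingCat.of R))) (q : X ⟶ Q) (t : Q ⟶ Y),
      IsFinite Q.hom ∧ Flat Q.hom ∧ Saturated q ∧ GenericIso t ∧ q ≫ t = w := by
  have : IsAffine X.left := Sec.isAffine_of_isFinite X
  have := Sec.algebraMap_finite (X := X)
  have := Sec.flat (X := X)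
  let B := saturation (Sec.map w).range
  have hle (y : Sec Y) : Sec.map w y ∈ B := ⟨1, one_ne_zero, by rw [one_smul]; exact ⟨y, rfl⟩⟩
  have : Module.Finite R B :=
    inferInstanceAs (Module.Finite R (Subalgebra.toSubmodule B))
  have : Module.IsTorsionFree R B := inferInstance
  obtain ⟨Q, e, t, hQ, hQ', ht, het⟩ := exists_genericIso (Y := Y) B
    (σ := (Sec.map w).codRestrict B hle)
    (fun y y' h => hw (congrArg Subtype.val h)) (by
      rintro ⟨b, r, hr, y, hy⟩
      exact ⟨r, hr, y, Subtype.ext hy⟩)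
  have : IsAffine Q.left := Sec.isAffine_of_isFinite Q
  obtain ⟨q, hq⟩ := Sec.exists_hom (B.val.comp (e : Sec Q →ₐ[R] B))
  have hq' (x) : Sec.map q x = e x := by rw [hq]; rfl
  refine ⟨Q, q, t, hQ, hQ', ⟨?_, fun r x hr => ?_⟩, ht, Sec.hom_ext fun y => ?_⟩
  · rw [hq]; exact Subtype.val_injective.comp e.injective
  · rintro ⟨y, hy : Sec.map q y = r • x⟩
    obtain ⟨s, hs, hsy⟩ := (e y).2
    rw [← hq', hy, smul_smul] at hsy
    refine ⟨e.symm ⟨x, s * r, mul_ne_zero hs hr, hsy⟩, ?_⟩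
    refine (hq' _).trans ?_
    rw [e.apply_symm_apply]
  · rw [Sec.map_comp_apply, hq', het]; rfl

variable {K : Type u} [Field K] [Algebra R K] [IsFractionRing R K]

/-- The schematic closure of the graph of a morphism `φ` between the generic fibres of two finite
flat `R`-schemes `X` and `P`: a finite flat model of the generic fibre of `X` to which `φ` extends,
and which is universal for this property. -/
lemma exists_graphClosure [IsFinite X.hom] [Flat X.hom] [IsFinite P.hom]
    (φ : (Over.pullback (specMap R K)).obj X ⟶ (Over.pullback (specMap R K)).obj P) :
    ∃ (Γ : Over (Spec (CommRingCat.of R))) (p₁ : Γ ⟶ X) (p₂ : Γ ⟶ P),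
      IsFinite Γ.hom ∧ Flat Γ.hom ∧ GenericIso p₁ ∧
      (Over.pullback (specMap R K)).map p₂ = (Over.pullback (specMap R K)).map p₁ ≫ φ ∧
      ∀ (T : Over (Spec (CommRingCat.of R))) [IsAffine T.left] [Flat T.hom] (a : T ⟶ X) (c : T ⟶ P),
        (Over.pullback (specMap R K)).map a ≫ φ = (Over.pullback (specMap R K)).map c →
        ∃ m : T ⟶ Γ, m ≫ p₁ = a ∧ m ≫ p₂ = c := by
  have : IsAffine X.left := Sec.isAffine_of_isFinite X
  have : IsAffine P.left := Sec.isAffine_of_isFinite P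
  have := Sec.algebraMap_finite (X := X)
  have := Sec.algebraMap_finite (X := P)
  let f₁ := Sec.map (genericFibreι K X)
  let f₂ := Sec.map (genericMap φ ≫ genericFibreι K P)
  let B := f₁.range ⊔ f₂.range
  have : Module.Finite R f₁.range := Module.Finite.of_surjective f₁.rangeRestrict.toLinearMap
    f₁.rangeRestrict_surjective
  have : Module.Finite R f₂.range := Module.Finite.of_surjective f₂.rangeRestrict.toLinearMap
    f₂.rangeRestrict_surjective
  have : Module.Finite R B := Subalgebra.finite_sup _ _
  have : Module.IsTorsionFree R (Sec (genericFibre K X)) := by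
    exact ⟨fun r hr x y h => genericFibre_smul_cancel hr.ne_zero h⟩
  have : Module.IsTorsionFree R B := inferInstance
  have hf₁ (x) : f₁ x ∈ B := (le_sup_left : f₁.range ≤ B) ⟨x, rfl⟩
  have hf₂ (x) : f₂ x ∈ B := (le_sup_right : f₂.range ≤ B) ⟨x, rfl⟩
  obtain ⟨Γ, e, p₁, hΓ, hΓ', hp₁, hep₁⟩ := exists_genericIso (Y := X) B
    (σ := f₁.codRestrict B hf₁)
    (fun y y' h => map_genericFibreι_injective (congrArg Subtype.val h)) (by
      rintro ⟨b, hb⟩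
      obtain ⟨r, hr, y, hy⟩ := genericFibre_exists_smul b
      exact ⟨r, hr, y, Subtype.ext hy⟩)
  have : IsAffine Γ.left := Sec.isAffine_of_isFinite Γ
  obtain ⟨p₂, hp₂⟩ := Sec.exists_hom ((e.symm : B →ₐ[R] Sec Γ).comp (f₂.codRestrict B hf₂))
  have hep₂ (y) : e (Sec.map p₂ y) = f₂.codRestrict B hf₂ y := by
    rw [hp₂]; exact e.apply_symm_apply _
  -- the isomorphism of `B` with the coordinate ring of `Γ` is compatible with the embeddings of
  -- both into the coordinate ring of the generic fibre
  have hgen (g : Sec Γ) : Sec.map (genericFibreι K Γ) g =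
      Sec.map (genericMap ((Over.pullback (specMap R K)).map p₁))
        (e g : Sec (genericFibre K X)) := by
    obtain ⟨r, hr, x, hx⟩ := hp₁.exists_smul g
    refine genericFibre_smul_cancel hr ?_
    have h1 : r • (e g : Sec (genericFibre K X)) = f₁ x := by
      rw [← SetLike.val_smul, ← map_smul, ← hx, hep₁]; rfl
    rw [← map_smul, ← map_smul, ← hx, h1, ← Sec.map_comp_apply, ← Sec.map_comp_apply,
      genericMap_map_comp_ι]
  refine ⟨Γ, p₁, p₂, hΓ, hΓ', hp₁, ?_, fun T _ _ a c hac => ?_⟩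
  · refine eq_of_genericMap_comp_ι_eq (Sec.hom_ext fun y => ?_)
    rw [genericMap_map_comp_ι, Sec.map_comp_apply, hgen, hep₂, genericMap_comp, Category.assoc,
      Sec.map_comp_apply]
    rfl
  · let g := Sec.map (genericMap ((Over.pullback (specMap R K)).map a))
    have hg₁ (x) : g (f₁ x) = Sec.map (genericFibreι K T) (Sec.map a x) := by
      rw [← Sec.map_comp_apply, ← Sec.map_comp_apply, genericMap_map_comp_ι]
    have hg₂ (y) : g (f₂ y) = Sec.map (genericFibreι K T) (Sec.map c y) := by
      rw [← Sec.map_comp_apply, ← Sec.map_comp_apply, ← Category.assoc, ← genericMap_comp, hac,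
        genericMap_map_comp_ι]
    have hB : B ≤ (Sec.map (genericFibreι K T)).range.comap g := by
      refine sup_le ?_ ?_
      · rintro _ ⟨x, rfl⟩; exact ⟨_, (hg₁ x).symm⟩
      · rintro _ ⟨x, rfl⟩; exact ⟨_, (hg₂ x).symm⟩
    obtain ⟨s, hs⟩ := exists_algHom_comp_eq (g.comp B.val)
      (map_genericFibreι_injective (K := K) (X := T)) fun b => hB b.2
    obtain ⟨m, hm⟩ := Sec.exists_hom (s.comp (e : Sec Γ →ₐ[R] B))
    have hm' (x) : Sec.map (genericFibreι K T) (Sec.map m x) = g (e x) := by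
      rw [hm]; exact hs (e x)
    refine ⟨m, Sec.hom_ext fun x => map_genericFibreι_injective (K := K) ?_,
      Sec.hom_ext fun x => map_genericFibreι_injective (K := K) ?_⟩
    · rw [Sec.map_comp_apply, hm', hep₁]; exact hg₁ x
    · rw [Sec.map_comp_apply, hm', hep₂]; exact hg₂ x

end Models

/-! ### Group structures on models -/

section GroupModels

variable {R : Type u} [CommRing R]

instance isAffine_tensorObj_left (X Y : Over (Spec (CommRingCat.of R))) [IsAffine X.left]
    [IsAffine Y.left] : IsAffine (X ⊗ Y).left :=
  inferInstanceAs (IsAffine (pullback X.hom Y.hom))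

instance flat_tensorObj_hom (X Y : Over (Spec (CommRingCat.of R))) [Flat X.hom] [Flat Y.hom] :
    Flat (X ⊗ Y).hom :=
  inferInstanceAs (Flat (pullback.fst X.hom Y.hom ≫ X.hom))

instance isAffine_tensorUnit_left : IsAffine (𝟙_ (Over (Spec (CommRingCat.of R)))).left :=
  inferInstanceAs (IsAffine (Spec (CommRingCat.of R)))

instance flat_tensorUnit_hom : Flat (𝟙_ (Over (Spec (CommRingCat.of R)))).hom :=
  inferInstanceAs (Flat (𝟙 (Spec (CommRingCat.of R))))

/-- A flat affine model `Q` of the generic fibre of a group scheme `G` to which the group operations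
extend is a group scheme; the group axioms can be checked after composing with `t : Q ⟶ G`. -/
lemma GenericIso.exists_groupScheme [IsDomain R] {G : GroupScheme (Spec (CommRingCat.of R))}
    {Q : Over (Spec (CommRingCat.of R))} [IsAffine Q.left] [Flat Q.hom]
    {t : Q ⟶ G.X} (ht : GenericIso t) {m : Q ⊗ Q ⟶ Q} {e : 𝟙_ _ ⟶ Q} {n : Q ⟶ Q}
    (hm : m ≫ t = (fst Q Q ≫ t) * (snd Q Q ≫ t)) (he : e ≫ t = 1) (hn : n ≫ t = t⁻¹) :
    ∃ (P : GroupScheme (Spec (CommRingCat.of R))) (t' : P ⟶ G) (i : P.X ≅ Q),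
      homOver t' = i.hom ≫ t := by
  let : GrpObj Q :=
    { one := e
      mul := m
      inv := n
      one_mul := ht.hom_ext <| by
        simp [hm, he, comp_mul, leftUnitor_hom]
      mul_one := ht.hom_ext <| by
        simp [hm, he, comp_mul, rightUnitor_hom]
      mul_assoc := ht.hom_ext <| by
        simp [hm, comp_mul, _root_.mul_assoc]
      left_inv := ht.hom_ext <| by
        simp [hm, he, hn, comp_mul]
      right_inv := ht.hom_ext <| by
        simp [hm, he, hn, comp_mul] }
  have : IsCommMonObj Q := ⟨ht.hom_ext <| by
    change (β_ Q Q).hom ≫ m ≫ t = m ≫ t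
    simp [hm, comp_mul, _root_.mul_comm]⟩
  have : IsMonHom t :=
    ⟨by rw [one_eq_one]; exact he, by
      change m ≫ t = _
      rw [hm, mul_eq_mul, comp_mul]
      simp⟩
  exact ⟨⟨Q⟩, InducedCategory.homMk (Grp.homMk t), Iso.refl _, (Category.id_comp _).symm⟩

end GroupModels

/-! ### Unique prolongations -/

section UniqueProlongation

variable {R K : Type u} [CommRing R] [IsDomain R] [Field K] [CharZero K] [Algebra R K]
  [IsFractionRing R K]

/-- If `G` is the only prolongation of its generic fibre, every homomorphism from a finite flat
group scheme to `G` that is a generic isomorphism is an isomorphism: its source is abstractly isomorphic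
to `G`, and endomorphisms of `G` that are generic isomorphisms are isomorphisms. -/
lemma IsUniqueProlongation.isIso_of_genericIso {P G : GroupScheme (Spec (CommRingCat.of R))}
    (hG : IsUniqueProlongation (specMap R K) ((baseChange (specMap R K)).obj G) G)
    (hP : IsFiniteFlat P) (t : P ⟶ G) (ht : GenericIso (homOver t)) : IsIso (homOver t) := by
  have := hP.finite
  have := hP.flat
  have := hG.1.1.finite
  have := hG.1.1.flat
  have : IsAffine P.X.left := Sec.isAffine_of_isFinite P.X
  have : IsAffine G.X.left := Sec.isAffine_of_isFinite G.X
  have hiso : IsIso ((Over.pullback (specMap R K)).map (homOver t)) := ht.isIso_map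
  let tK := (baseChange (specMap R K)).map t
  have : IsIso (homOver tK) := hiso
  have : IsMonHom (asIso (homOver tK)).hom := inferInstanceAs (IsMonHom tK.hom.hom.hom)
  obtain ⟨α⟩ := hG.2 P ⟨hP, ⟨CommGrp.mkIso' (asIso (homOver tK))⟩⟩
  have hα : IsIso (homOver α.inv) := inferInstanceAs (IsIso ((CommGrp.forget _).map α.inv))
  have : IsIso ((Over.pullback (specMap R K)).map (homOver α.inv ≫ homOver t)) := by
    rw [Functor.map_comp]
    infer_instance
  have := isIso_of_isIso_map K G (homOver α.inv ≫ homOver t)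
  exact IsIso.of_isIso_comp_left (homOver α.inv) (homOver t)

end UniqueProlongation

/-! ### Extending homomorphisms from the generic fibre -/

section Homomorphisms

variable {S S' : Scheme.{u}} {f : S' ⟶ S} {E E' : GroupScheme S} {T : Over S}
  (φ : (baseChange f).obj E ⟶ (baseChange f).obj E')

/-- If `φ a = c` and `φ b = d` on generic fibres, then `φ (a * b) = c * d` on generic fibres. -/
lemma map_mul_comp {a b : T ⟶ E.X} {c d : T ⟶ E'.X}
    (hac : (Over.pullback f).map a ≫ homOver φ = (Over.pullback f).map c)
    (hbd : (Over.pullback f).map b ≫ homOver φ = (Over.pullback f).map d) :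
    (Over.pullback f).map (a * b) ≫ homOver φ = (Over.pullback f).map (c * d) := by
  have h1 := Functor.map_mul (Over.pullback f) a b
  have h2 := Functor.map_mul (Over.pullback f) c d
  have h3 := MonObj.mul_comp (M := ((baseChange f).obj E).X) ((Over.pullback f).map a)
    ((Over.pullback f).map b) (homOver φ)
  rw [h2, h1, ← hac, ← hbd]
  exact h3

lemma map_one_comp : (Over.pullback f).map (1 : T ⟶ E.X) ≫ homOver φ =
    (Over.pullback f).map (1 : T ⟶ E'.X) := by
  have h1 := Functor.map_one (Over.pullback f) (X := T) (M := E.X)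
  have h2 := Functor.map_one (Over.pullback f) (X := T) (M := E'.X)
  have h3 := MonObj.one_comp (M := ((baseChange f).obj E).X) (X := (Over.pullback f).obj T)
    (homOver φ)
  rw [h2, h1]
  exact h3

lemma map_inv_comp {a : T ⟶ E.X} {c : T ⟶ E'.X}
    (hac : (Over.pullback f).map a ≫ homOver φ = (Over.pullback f).map c) :
    (Over.pullback f).map a⁻¹ ≫ homOver φ = (Over.pullback f).map c⁻¹ := by
  have h1 := Functor.map_inv' (Over.pullback f) a
  have h2 := Functor.map_inv' (Over.pullback f) c
  have h3 := GrpObj.inv_comp (G := ((baseChange f).obj E).X) ((Over.pullback f).map a) (homOver φ)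
  rw [h2, h1, ← hac]
  exact h3

end Homomorphisms

section

variable {R K : Type u} [CommRing R] [IsDedekindDomain R] [Field K] [Algebra R K]
  [IsFractionRing R K] {G H : GroupScheme (Spec (CommRingCat.of R))}

lemma map_injective_of_flat_of_surjective {R : Type u} [CommRing R]
    {X Y : Over (Spec (CommRingCat.of R))} [IsAffine X.left] [IsAffine Y.left] (g : X ⟶ Y)
    [Flat g.left] [Surjective g.left] :
    Function.Injective (Sec.map g) :=
  RingHom.FaithfullyFlat.injective
    ((Flat.flat_and_surjective_iff_faithfullyFlat_of_isAffine g.left).1 ⟨‹_›, ‹_›⟩)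

/-- Base change to the generic fibre is faithful on finite flat group schemes. -/
lemma hom_ext_baseChange {E E' : GroupScheme (Spec (CommRingCat.of R))} (hE : IsFiniteFlat E)
    (hE' : IsFiniteFlat E') {g g' : E ⟶ E'}
    (h : (baseChange (specMap R K)).map g = (baseChange (specMap R K)).map g') : g = g' := by
  have := hE.finite
  have := hE.flat
  have := hE'.finite
  have : IsAffine E.X.left := Sec.isAffine_of_isFinite _
  have : IsAffine E'.X.left := Sec.isAffine_of_isFinite _
  exact CommGrp.hom_ext _ _ (hom_ext_genericFibre (K := K) (congrArg homOver h))

/-- A homomorphism of generic fibres whose underlying morphism extends, extends to a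
homomorphism. -/
lemma exists_baseChange_map_eq {E E' : GroupScheme (Spec (CommRingCat.of R))} (hE : IsFiniteFlat E)
    (hE' : IsFiniteFlat E')
    (φ : (baseChange (specMap R K)).obj E ⟶ (baseChange (specMap R K)).obj E')
    {g : E.X ⟶ E'.X} (hg : (Over.pullback (specMap R K)).map g = homOver φ) :
    ∃ g' : E ⟶ E', (baseChange (specMap R K)).map g' = φ := by
  have := hE.finite
  have := hE.flat
  have := hE'.finite
  have : IsAffine E.X.left := Sec.isAffine_of_isFinite _
  have : IsAffine E'.X.left := Sec.isAffine_of_isFinite _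
  have : IsMonHom g := by
    refine ⟨hom_ext_genericFibre (K := K) ?_, hom_ext_genericFibre (K := K) ?_⟩
    · rw [Functor.map_comp, hg, one_eq_one, one_eq_one]
      exact map_one_comp φ
    · rw [Functor.map_comp, hg, mul_eq_mul, mul_eq_mul, comp_mul, tensorHom_fst, tensorHom_snd]
      exact map_mul_comp φ (by rw [Functor.map_comp, hg]; rfl)
        (by rw [Functor.map_comp, hg]; rfl)
  exact ⟨InducedCategory.homMk (Grp.homMk g), CommGrp.hom_ext _ _ hg⟩

variable [CharZero K]

/-- Let `Γ` be the closure of the graph of `φ`, with projections `p₁` and `p₂`. If `G` is the only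
prolongation of its generic fibre, the morphism `Γ ⟶ G` is saturated. -/
lemma saturated_graphClosure
    (hG : IsUniqueProlongation (specMap R K) ((baseChange (specMap R K)).obj G) G)
    {E E' : GroupScheme (Spec (CommRingCat.of R))} (hE : IsFiniteFlat E) (p : E ⟶ G)
    [Flat (homOver p).left] [Surjective (homOver p).left]
    (φ : (baseChange (specMap R K)).obj E ⟶ (baseChange (specMap R K)).obj E')
    {Γ : Over (Spec (CommRingCat.of R))} [IsFinite Γ.hom] [Flat Γ.hom] {p₁ : Γ ⟶ E.X}
    {p₂ : Γ ⟶ E'.X} (hp₁ : GenericIso p₁)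
    (hp₂ : (Over.pullback (specMap R K)).map p₁ ≫ homOver φ = (Over.pullback (specMap R K)).map p₂)
    (hΓ : ∀ (T : Over (Spec (CommRingCat.of R))) [IsAffine T.left] [Flat T.hom] (a : T ⟶ E.X)
      (c : T ⟶ E'.X),
      (Over.pullback (specMap R K)).map a ≫ homOver φ = (Over.pullback (specMap R K)).map c →
        ∃ m : T ⟶ Γ, m ≫ p₁ = a ∧ m ≫ p₂ = c) :
    Saturated (p₁ ≫ homOver p) := by
  have := hE.finite
  have := hG.1.1.finite
  have := hG.1.1.flat
  have : IsAffine E.X.left := Sec.isAffine_of_isFinite E.X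
  have : IsAffine G.X.left := Sec.isAffine_of_isFinite G.X
  have : IsAffine Γ.left := Sec.isAffine_of_isFinite Γ
  have hw : Function.Injective (Sec.map (p₁ ≫ homOver p)) := by
    have : (Sec.map (p₁ ≫ homOver p) : Sec G.X → Sec Γ) = Sec.map p₁ ∘ Sec.map (homOver p) :=
      funext fun z => Sec.map_comp_apply _ _ z
    rw [this]
    exact hp₁.injective.comp (map_injective_of_flat_of_surjective (homOver p))
  obtain ⟨Q, q, t, hQ, hQ', hq, ht, hqt⟩ :=
    exists_saturated_genericIso_factorization (p₁ ≫ homOver p) hw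
  have : IsAffine Q.left := Sec.isAffine_of_isFinite Q
  -- the group operations extend to `Γ`, and descend to `Q` because `q` is saturated
  obtain ⟨mΓ, hmΓ, -⟩ := hΓ (Γ ⊗ Γ) ((fst Γ Γ ≫ p₁) * (snd Γ Γ ≫ p₁))
    ((fst Γ Γ ≫ p₂) * (snd Γ Γ ≫ p₂)) (map_mul_comp φ
      (by rw [Functor.map_comp, Functor.map_comp, ← hp₂]; exact Category.assoc _ _ _)
      (by rw [Functor.map_comp, Functor.map_comp, ← hp₂]; exact Category.assoc _ _ _))
  obtain ⟨eΓ, heΓ, -⟩ := hΓ (𝟙_ _) 1 1 (map_one_comp φ)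
  obtain ⟨nΓ, hnΓ, -⟩ := hΓ Γ p₁⁻¹ p₂⁻¹ (map_inv_comp φ hp₂)
  obtain ⟨m, -, hm⟩ := hq.tensorHom_self.exists_lift ht (k := (fst Q Q ≫ t) * (snd Q Q ≫ t))
    (l := mΓ ≫ q) (by
      rw [Category.assoc, hqt, ← Category.assoc, hmΓ, MonObj.mul_comp, comp_mul]
      simp [hqt])
  obtain ⟨n, -, hn⟩ := hq.exists_lift ht (k := t⁻¹) (l := nΓ ≫ q) (by
      rw [Category.assoc, hqt, ← Category.assoc, hnΓ, GrpObj.inv_comp, GrpObj.comp_inv, hqt])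
  have he : (eΓ ≫ q) ≫ t = 1 := by
    rw [Category.assoc, hqt, ← Category.assoc, heΓ, MonObj.one_comp]
  obtain ⟨P, t', i, ht'⟩ := ht.exists_groupScheme hm he hn
  have hP : IsFiniteFlat P := by
    have hi : P.X.hom = i.hom.left ≫ Q.hom := (Over.w i.hom).symm
    have : IsIso i.hom.left := inferInstanceAs (IsIso ((Over.forget _).map i.hom))
    exact ⟨by rw [hi]; infer_instance, by rw [hi]; infer_instance⟩
  have := hG.isIso_of_genericIso hP t' (ht' ▸ ht.iso_comp i)
  have : IsIso t := by
    rw [← i.inv_hom_id_assoc t, ← ht']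
    infer_instance
  rw [← hqt]
  exact hq.comp (.of_isIso t)

/-- The morphism `φ` extends. With `T = E ×_G Γ`, the projection `T ⟶ E` is saturated, being a flat
base change of `Γ ⟶ G`. The inverse of the generic isomorphism `Γ ⟶ E` extends after composition
with `T ⟶ E`, because a point `(x, γ)` of `T` satisfies `x = p₁ γ + i h` for a point `h` of `H`; so
it extends. -/
lemma Extension.exists_map_eq (hG : IsUniqueProlongation (specMap R K)
      ((FFGroupScheme.baseChange (specMap R K)).obj G) G) (X Y : Extension G H)
    (φ : (X.baseChange (specMap R K)).E ⟶ (Y.baseChange (specMap R K)).E)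
    (hi : (X.baseChange (specMap R K)).i ≫ φ = (Y.baseChange (specMap R K)).i) :
    ∃ g : X.E.X ⟶ Y.E.X, (Over.pullback (specMap R K)).map g = homOver φ := by
  have := X.isFiniteFlat.finite
  have := X.isFiniteFlat.flat
  have := Y.isFiniteFlat.finite
  have := hG.1.1.finite
  have : IsAffine X.E.X.left := Sec.isAffine_of_isFinite _
  have : IsAffine G.X.left := Sec.isAffine_of_isFinite _
  have := X.exact.flat
  have := X.exact.surjective
  obtain ⟨Γ, p₁, p₂, hΓ, hΓ', hp₁, hp₂, hlift⟩ :=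
    exists_graphClosure (X := X.E.X) (P := Y.E.X) (homOver φ)
  have : IsAffine Γ.left := Sec.isAffine_of_isFinite Γ
  have hsat := saturated_graphClosure hG X.isFiniteFlat X.p φ hp₁ hp₂.symm hlift
  let T : Over (Spec (CommRingCat.of R)) :=
    Over.mk (pullback.snd (homOver X.p).left (p₁ ≫ homOver X.p).left ≫ Γ.hom)
  let b : T ⟶ Γ := Over.homMk (pullback.snd _ _) rfl
  let a : T ⟶ X.E.X := Over.homMk (pullback.fst (homOver X.p).left (p₁ ≫ homOver X.p).left) (by
    rw [← Over.w (homOver X.p), pullback.condition_assoc, Over.w]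
    rfl)
  have hab : a ≫ homOver X.p = b ≫ p₁ ≫ homOver X.p := by
    ext1
    exact pullback.condition
  have : IsAffine T.left :=
    inferInstanceAs (IsAffine (pullback (homOver X.p).left (p₁ ≫ homOver X.p).left))
  have : Flat T.hom := inferInstanceAs
    (Flat (pullback.snd (homOver X.p).left (p₁ ≫ homOver X.p).left ≫ Γ.hom))
  have ha : Saturated a := Saturated.of_isPullback (b := b) (p := homOver X.p)
    (IsPullback.of_hasPullback _ _) hsat
  -- the difference of the two points of `E` lies in the kernel `H`
  let h : T ⟶ H.X := X.exact.kernel.lift ((b ≫ p₁)⁻¹ * a) (toUnit T) (by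
    rw [MonObj.mul_comp, GrpObj.inv_comp, hab, Category.assoc, inv_mul_cancel]
    rfl)
  have hh : (b ≫ p₁) * (h ≫ homOver X.i) = a := by
    rw [X.exact.kernel.lift_fst, mul_inv_cancel_left]
  have hi' : (Over.pullback (specMap R K)).map (homOver X.i) ≫ homOver φ =
      (Over.pullback (specMap R K)).map (homOver Y.i) := congrArg homOver hi
  obtain ⟨m, hm, -⟩ := hlift T a ((b ≫ p₂) * (h ≫ homOver Y.i)) (by
    conv_lhs => rw [← hh]
    refine map_mul_comp φ ?_ ?_
    · rw [Functor.map_comp, Functor.map_comp, hp₂]; exact Category.assoc _ _ _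
    · rw [Functor.map_comp, Functor.map_comp, ← hi']; exact Category.assoc _ _ _)
  -- `m` is the partial inverse of `p₁` on `T`; it descends to a section of `p₁`
  obtain ⟨s, -, hs⟩ := ha.exists_lift hp₁ (k := 𝟙 _) (l := m) (by rw [Category.comp_id, hm])
  refine ⟨s ≫ p₂, ?_⟩
  have hs' : (Over.pullback (specMap R K)).map s ≫ (Over.pullback (specMap R K)).map p₁ = 𝟙 _ := by
    rw [← Functor.map_comp, hs]
    exact CategoryTheory.Functor.map_id _ _
  rw [Functor.map_comp, hp₂]
  exact (Category.assoc _ _ _).symm.trans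
    ((congrArg (· ≫ homOver φ) hs').trans (Category.id_comp _))

end

end FFGroupScheme

theorem mainTheorem8 (R K : Type u) [CommRing R] [IsDedekindDomain R] [Field K] [CharZero K]
    [Algebra R K] [IsFractionRing R K]
    (G H : FFGroupScheme.GroupScheme (Spec (CommRingCat.of R)))
    (hG : FFGroupScheme.IsFiniteFlat G) (hH : FFGroupScheme.IsFiniteFlat H)
    (hunique : FFGroupScheme.IsUniqueProlongation (FFGroupScheme.specMap R K)
      ((FFGroupScheme.baseChange (FFGroupScheme.specMap R K)).obj G) G) :
    Function.Injective (FFGroupScheme.Ext1.baseChange (FFGroupScheme.specMap R K) G H) := by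
  open FFGroupScheme in
  rintro ⟨X⟩ ⟨Y⟩ hXY
  obtain ⟨e, hi, hp⟩ := Quotient.exact hXY
  have hi' : (Y.baseChange (specMap R K)).i ≫ e.inv = (X.baseChange (specMap R K)).i := by
    rw [← hi, Category.assoc, e.hom_inv_id, Category.comp_id]
  obtain ⟨_, hg⟩ := Extension.exists_map_eq hunique X Y e.hom hi
  obtain ⟨g, hg⟩ := exists_baseChange_map_eq X.isFiniteFlat Y.isFiniteFlat e.hom hg
  obtain ⟨_, hg'⟩ := Extension.exists_map_eq hunique Y X e.inv hi'
  obtain ⟨g', hg'⟩ := exists_baseChange_map_eq Y.isFiniteFlat X.isFiniteFlat e.inv hg'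
  refine Quotient.sound ⟨⟨g, g', ?_, ?_⟩, ?_, ?_⟩
  · refine hom_ext_baseChange (K := K) X.isFiniteFlat X.isFiniteFlat ?_
    rw [Functor.map_comp, hg, hg']
    exact e.hom_inv_id.trans ((baseChange (specMap R K)).map_id X.E).symm
  · refine hom_ext_baseChange (K := K) Y.isFiniteFlat Y.isFiniteFlat ?_
    rw [Functor.map_comp, hg', hg]
    exact e.inv_hom_id.trans ((baseChange (specMap R K)).map_id Y.E).symm
  · refine hom_ext_baseChange (K := K) hH Y.isFiniteFlat ?_
    rw [Functor.map_comp, hg]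
    exact hi
  · refine hom_ext_baseChange (K := K) X.isFiniteFlat hG ?_
    rw [Functor.map_comp, hg]
    exact hp
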